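/- Let $d \ge 3$ and let $Q=(1,d,d+1,\dots,d+1)\in\mathbb{Z}^{d+1}$, with $d-1$ entries equal to $d+1$. Put $v_0=(-d,-d-1,\dots,-d-1)\in\mathbb{Z}^d$ and $v_i=e_i$ for $1\le i\le d$, and let $\Delta_Q=\mathrm{conv}(v_0,\dots,v_d)\subset\mathbb{R}^d$. Then: 1. $\Delta_Q$ is a $d$-dimensional simplex (the points $v_0,\dots,v_d$ are affinely independent) of type $(Q,1)$, that is, $\left|\det(v_0,\dots,\widehat{v_i},\dots,v_d)\right|=q_i$ for every $i$, where $Q=(q_0,\dots,q_d)$, and $\gcd(q_0,\dots,q_d)=1$. 2. $\Delta_Q$ is integrally closed: for every integer $m\ge 0$, each point of $m\Delta_Q\cap\mathbb{Z}^d$ is a sum of $m$ points of $\Delta_Q\cap\mathbb{Z}^d$. 3. $\Delta_Q$ is reflexive: $0$ is an interior point of $\Delta_Q$, and the polar dual $\{y\in\mathbb{R}^d : x\cdot y\le 1 \text{ for all } x\in\Delta_Q\}$ is a lattice polytope, i.e. the convex hull of finitely many points of $\mathbb{Z}^d$. 4. Let $\mathbb{C}[\Delta_Q]=\mathbb{C}[x^az^m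 : m\in\mathbb{Z}_{\ge 0},\ a\in m\Delta_Q\cap\mathbb{Z}^d]$ be the semigroup algebra of $\Delta_Q$ and $R=\mathbb{C}[\Delta_Q]/(x^{v_0}z,\dots,x^{v_d}z)$, graded by the exponent of $z$, with graded pieces $[R]_i$. Then $R$ is Artinian, and for every linear form $l\in[R]_1$ the multiplication map $\times l:[R]_1\to[R]_2$ is not injective. Moreover $R$ has no weak Lefschetz element: there is no $l\in[R]_1$ such that for every $i\ge 0$ the map $\times l:[R]_i\to[R]_{i+1}$ is injective or surjective. -/

import Mathlib

open scoped Pointwise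

noncomputable section

namespace LatticeSimplex

/-- The inclusion of the lattice `ℤⁿ` into `ℝⁿ`. -/
def toReal {n : ℕ} (a : Fin n → ℤ) : Fin n → ℝ := fun i => (a i : ℝ)

/-- A lattice polytope in `ℝⁿ`: the convex hull of finitely many lattice points. -/
def IsLatticePolytope {n : ℕ} (P : Set (Fin n → ℝ)) : Prop :=
  ∃ S : Finset (Fin n → ℤ), P = convexHull ℝ (toReal '' (S : Set (Fin n → ℤ)))

/-- The polar dual `{y | x ⬝ y ≤ 1 for all x ∈ P}`. -/
def polarDual {n : ℕ} (P : Set (Fin n → ℝ)) : Set (Fin n → ℝ) :=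
  {y | ∀ x ∈ P, x ⬝ᵥ y ≤ 1}

/-- Reflexive, in the strict sense (the origin itself is the interior lattice point,
no lattice translation is allowed). -/
def IsReflexive {n : ℕ} (P : Set (Fin n → ℝ)) : Prop :=
  IsLatticePolytope P ∧ (0 : Fin n → ℝ) ∈ interior P ∧ IsLatticePolytope (polarDual P)

/-- Integrally closed: every lattice point of `mP` is a sum of `m` lattice points of `P`. -/
def IsIntegrallyClosed {n : ℕ} (P : Set (Fin n → ℝ)) : Prop :=
  IsLatticePolytope P ∧
    ∀ (m : ℕ) (x : Fin n → ℤ), toReal x ∈ (m : ℝ) • P →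
      ∃ y : Fin m → (Fin n → ℤ), (∀ j, toReal (y j) ∈ P) ∧ x = ∑ j, y j

/-- The polytope in `ℝⁿ` spanned by the lattice points `v₀, …, vₙ`. -/
def simplex {n : ℕ} (v : Fin (n + 1) → (Fin n → ℤ)) : Set (Fin n → ℝ) :=
  convexHull ℝ (Set.range fun i => toReal (v i))

/-- The weights `qᵢ = |det (v₀, …, v̂ᵢ, …, vₙ)|` (here the vectors are the rows). -/
def weight {n : ℕ} (v : Fin (n + 1) → (Fin n → ℤ)) (i : Fin (n + 1)) : ℕ :=
  (Matrix.det (Matrix.of fun j : Fin n => v (i.succAbove j))).natAbs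

/-- `v` has type `(Q, lam)`: `lam` is the gcd of the weights and `Q` is the weight vector
divided by `lam`. -/
def HasType {n : ℕ} (v : Fin (n + 1) → (Fin n → ℤ)) (Q : Fin (n + 1) → ℕ) (lam : ℕ) : Prop :=
  lam = Finset.univ.gcd (weight v) ∧ ∀ i, weight v i = lam * Q i

/-- The monoid of pairs `(a, m)` with `a ∈ mP ∩ ℤⁿ`, where `P` is the polytope spanned by `v`;
`(a, m)` is the exponent of the monomial `xᵃ zᵐ`. -/
def coneMonoid {n : ℕ} (v : Fin (n + 1) → (Fin n → ℤ)) : AddSubmonoid ((Fin n → ℤ) × ℕ) where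
  carrier := {p | toReal p.1 ∈ (p.2 : ℝ) • simplex v}
  zero_mem' := by
    have hne : (simplex v).Nonempty :=
      ⟨toReal (v 0), subset_convexHull ℝ _ (Set.mem_range_self 0)⟩
    have h0 : toReal (0 : Fin n → ℤ) = 0 := by
      funext i
      simp [toReal]
    simp [h0, Set.zero_smul_set hne]
  add_mem' := by
    intro p q hp hq
    have hadd : toReal (p.1 + q.1) = toReal p.1 + toReal q.1 := by
      funext i
      simp [toReal]
    have hconv : Convex ℝ (simplex v) := convex_convexHull ℝ _
    simp only [Set.mem_ofPred_eq, Prod.fst_add, Prod.snd_add, Nat.cast_add] at hp hq ⊢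
    rw [hconv.add_smul (Nat.cast_nonneg _) (Nat.cast_nonneg _), hadd]
    exact Set.add_mem_add hp hq

/-- The exponent `(vᵢ, 1)` of the monomial `x^{vᵢ} z`. -/
def vertexExponent {n : ℕ} (v : Fin (n + 1) → (Fin n → ℤ)) (i : Fin (n + 1)) : coneMonoid v :=
  ⟨(v i, 1), by
    have h : toReal (v i) ∈ simplex v := subset_convexHull ℝ _ (Set.mem_range_self i)
    simpa [coneMonoid] using h⟩

/-- The semigroup algebra `ℂ[P]`, with `ℂ`-basis the monomials `xᵃ zᵐ`, `a ∈ mP ∩ ℤⁿ`. -/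
abbrev SemigroupAlgebra {n : ℕ} (v : Fin (n + 1) → (Fin n → ℤ)) : Type :=
  AddMonoidAlgebra ℂ (coneMonoid v)

/-- The monomial `xᵃ zᵐ` for `s = (a, m)`. -/
def monomial {n : ℕ} (v : Fin (n + 1) → (Fin n → ℤ)) (s : coneMonoid v) : SemigroupAlgebra v :=
  AddMonoidAlgebra.single s 1

/-- The ideal `(x^{v₀} z, …, x^{vₙ} z)`. -/
def vertexIdeal {n : ℕ} (v : Fin (n + 1) → (Fin n → ℤ)) : Ideal (SemigroupAlgebra v) :=
  Ideal.span (Set.range fun i => monomial v (vertexExponent v i))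

/-- The quotient `R_P = ℂ[P] / (x^{v₀} z, …, x^{vₙ} z)`. -/
abbrev R {n : ℕ} (v : Fin (n + 1) → (Fin n → ℤ)) : Type :=
  SemigroupAlgebra v ⧸ vertexIdeal v

/-- The graded piece `[R_P]ₖ`, for the grading by the exponent of `z`. -/
def gradedPiece {n : ℕ} (v : Fin (n + 1) → (Fin n → ℤ)) (k : ℕ) : Submodule ℂ (R v) :=
  Submodule.span ℂ
    {f | ∃ s : coneMonoid v, s.1.2 = k ∧ f = Ideal.Quotient.mk (vertexIdeal v) (monomial v s)}

theorem mul_mem_gradedPiece {n : ℕ} (v : Fin (n + 1) → (Fin n → ℤ)) {j k : ℕ} {f g : R v}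
    (hf : f ∈ gradedPiece v j) (hg : g ∈ gradedPiece v k) : f * g ∈ gradedPiece v (k + j) := by
  have h := Submodule.mul_mem_mul hf hg
  rw [gradedPiece, gradedPiece, Submodule.span_mul_span] at h
  refine Submodule.span_mono ?_ h
  rintro _ ⟨_, ⟨s, hs, rfl⟩, _, ⟨t, ht, rfl⟩, rfl⟩
  refine ⟨s + t, by simp [hs, ht, add_comm], ?_⟩
  simp [monomial, ← map_mul, AddMonoidAlgebra.single_mul_single]

/-- Multiplication `× l : [R_P]ᵢ → [R_P]ᵢ₊₁` by a linear form `l ∈ [R_P]₁`. -/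
def mulMap {n : ℕ} (v : Fin (n + 1) → (Fin n → ℤ)) (l : gradedPiece v 1) (i : ℕ) :
    gradedPiece v i →ₗ[ℂ] gradedPiece v (i + 1) :=
  (LinearMap.mulLeft ℂ (l : R v)).restrict fun _ hf => mul_mem_gradedPiece v l.2 hf

/-- Weak Lefschetz element: every `× l : [R_P]ᵢ → [R_P]ᵢ₊₁` is injective or surjective. -/
def IsWeakLefschetz {n : ℕ} (v : Fin (n + 1) → (Fin n → ℤ)) (l : gradedPiece v 1) : Prop :=
  ∀ i : ℕ, Function.Injective (mulMap v l i) ∨ Function.Surjective (mulMap v l i)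

/-- The weight vector `Q = (1, d, d+1, …, d+1)`, with `d + 1` entries. -/
def weightQ (d : ℕ) : Fin (d + 1) → ℕ :=
  fun i => if (i : ℕ) = 0 then 1 else if (i : ℕ) = 1 then d else d + 1

/-- The vertices `(-d, -d-1, …, -d-1), e₁, …, e_d` of `Δ_Q`, in the order of the entries of `Q`. -/
def vertexQ (d : ℕ) : Fin (d + 1) → (Fin d → ℤ) :=
  Fin.cons (fun j : Fin d => if (j : ℕ) = 0 then -(d : ℤ) else -(d : ℤ) - 1)
    (fun i : Fin d => Pi.single i 1)

end LatticeSimplex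

end

/-!
Let `Δ` be the simplex with vertices `v₀ = (-q₁, …, -qₙ)` and `vⱼ = eⱼ`, and let
`N = 1 + q₁ + ⋯ + qₙ`. The monomials divisible by no vertex monomial `x^{vᵢ} z` form a basis of
`R`; their exponents are the `N` lattice points of the half-open parallelepiped spanned by the
`(vᵢ, 1)`. They are indexed by `0 ≤ t < N`, the point with index `t` having degree
`t - ∑ⱼ ⌊qⱼ t / N⌋`, and a product of basis monomials is either zero or the basis monomial whose
index is the sum. In particular `Δ` is integrally closed as soon as every index of positive degree
is the sum of an index of degree one and another index, with the degrees adding up. Independently of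
this, `Δ` is reflexive as soon as every `qⱼ` divides `N`: the polar dual then has the lattice
vertices `(1, …, 1)` and `(1, …, 1) - (N / qⱼ) eⱼ`.

For `q = (d, d + 1, …, d + 1)` we have `N = d (d + 1)`, and the index `t = d k + b` with `b < d` has
degree `b + [b < k]`. A nonzero product of two basis monomials of degree one, one of them with
index `d k`, has degree two and hence index `d m + 1` with `2 ≤ m ≤ d`. So every linear form maps
the `d`-dimensional span of the monomials with index `d k`, `1 ≤ k ≤ d`, into a space of dimension
`d - 1` and cannot be injective. Since `dim [R]₁ ≤ dim [R]₂`, it is not surjective either.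
-/

namespace LatticeSimplex

theorem sum_smul_mem_smul_convexHull_range {ι E : Type*} [Fintype ι] [Nonempty ι]
    [AddCommGroup E] [Module ℝ E] (p : ι → E) {w : ι → ℝ} (hw : ∀ i, 0 ≤ w i) :
    ∑ i, w i • p i ∈ (∑ i, w i) • convexHull ℝ (Set.range p) := by
  rcases (Finset.sum_nonneg fun i _ => hw i).eq_or_lt with hsum | hsum
  · have hzero : ∀ i, w i = 0 := fun i =>
      (Finset.sum_eq_zero_iff_of_nonneg fun i _ => hw i).1 hsum.symm i (Finset.mem_univ i)
    simp [hzero, Set.zero_smul_set (Set.range_nonempty p).convexHull]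
  · refine ⟨Finset.univ.centerMass w p, Finset.univ.centerMass_mem_convexHull
      (fun i _ => hw i) hsum fun i _ => Set.mem_range_self i, ?_⟩
    simp [Finset.centerMass, smul_smul, hsum.ne']

theorem isLatticePolytope_convexHull_range {n : ℕ} {ι : Type*} [Finite ι] (v : ι → Fin n → ℤ) :
    IsLatticePolytope (convexHull ℝ (Set.range fun i => toReal (v i))) :=
  ⟨(Set.finite_range v).toFinset, by rw [Set.Finite.coe_toFinset, ← Set.range_comp]; rfl⟩

theorem convex_polarDual {n : ℕ} (P : Set (Fin n → ℝ)) : Convex ℝ (polarDual P) := by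
  intro y hy z hz a b ha hb hab x hx
  rw [dotProduct_add, dotProduct_smul, dotProduct_smul, smul_eq_mul, smul_eq_mul, ← hab]
  exact add_le_add (mul_le_of_le_one_right ha (hy x hx)) (mul_le_of_le_one_right hb (hz x hx))

theorem mem_polarDual_convexHull_iff {n : ℕ} {S : Set (Fin n → ℝ)} {y : Fin n → ℝ} :
    y ∈ polarDual (convexHull ℝ S) ↔ ∀ x ∈ S, x ⬝ᵥ y ≤ 1 := by
  refine ⟨fun h x hx => h x (subset_convexHull ℝ S hx), fun h => ?_⟩
  have hconv : Convex ℝ {x : Fin n → ℝ | x ⬝ᵥ y ≤ 1} :=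
    convex_halfSpace_le ⟨fun a b => add_dotProduct a b y, fun c a => smul_dotProduct c a y⟩ 1
  exact fun x hx => convexHull_min h hconv hx

/-! ### Cone coordinates of a simplex -/

section Simplex

variable {n : ℕ} {v : Fin (n + 1) → Fin n → ℤ}

theorem linearIndependent_homogenization (hv : AffineIndependent ℝ fun i => toReal (v i)) :
    LinearIndependent ℝ fun i => (toReal (v i), (1 : ℝ)) := by
  refine Fintype.linearIndependent_iff.2 fun w hw i => ?_
  rw [Prod.ext_iff, Prod.fst_sum, Prod.snd_sum] at hw
  exact affineIndependent_iff.1 hv Finset.univ w (by simpa using hw.2) hw.1 i (Finset.mem_univ i)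

/-- The basis `(vᵢ, 1)` of `ℝⁿ × ℝ` attached to a simplex with vertices `vᵢ`. The coordinates of
`(y, 1)` are the barycentric coordinates of `y`. -/
noncomputable def coneBasis (hv : AffineIndependent ℝ fun i => toReal (v i)) :
    Module.Basis (Fin (n + 1)) ℝ ((Fin n → ℝ) × ℝ) :=
  basisOfLinearIndependentOfCardEqFinrank (linearIndependent_homogenization hv) (by simp)

variable (hv : AffineIndependent ℝ fun i => toReal (v i))

theorem coneBasis_apply (i : Fin (n + 1)) : coneBasis hv i = (toReal (v i), 1) := by
  simp [coneBasis]

theorem sum_coneBasis_repr_smul (y : Fin n → ℝ) (c : ℝ) :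
    ∑ i, (coneBasis hv).repr (y, c) i • toReal (v i) = y := by
  simpa [Prod.fst_sum, coneBasis_apply] using
    congrArg Prod.fst ((coneBasis hv).sum_repr (y, c))

theorem sum_coneBasis_repr (y : Fin n → ℝ) (c : ℝ) :
    ∑ i, (coneBasis hv).repr (y, c) i = c := by
  simpa [Prod.snd_sum, coneBasis_apply] using
    congrArg Prod.snd ((coneBasis hv).sum_repr (y, c))

theorem mem_smul_simplex_iff {c : ℝ} (hc : 0 ≤ c) {y : Fin n → ℝ} :
    y ∈ c • simplex v ↔ ∀ i, 0 ≤ (coneBasis hv).repr (y, c) i := by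
  constructor
  · rintro ⟨x, hx, rfl⟩ i
    have hconv : Convex ℝ {x | 0 ≤ (coneBasis hv).repr (x, 1) i} :=
      (convex_Ici (0 : ℝ)).affine_preimage
        (((coneBasis hv).coord i).toAffineMap.comp
          ((AffineMap.id ℝ _).prod (AffineMap.const ℝ (Fin n → ℝ) (1 : ℝ))))
    have hvertex : ∀ j, 0 ≤ (coneBasis hv).repr (toReal (v j), 1) i := fun j => by
      rw [← coneBasis_apply hv, Module.Basis.repr_self]
      exact Finsupp.single_nonneg.2 zero_le_one i
    have hsub : simplex v ⊆ {x | 0 ≤ (coneBasis hv).repr (x, 1) i} :=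
      convexHull_min (Set.range_subset_iff.2 hvertex) hconv
    have hscale : (c • x, c) = c • (x, (1 : ℝ)) := by simp
    change 0 ≤ (coneBasis hv).repr (c • x, c) i
    rw [hscale, map_smul]
    exact mul_nonneg hc (hsub hx)
  · intro h
    simpa only [sum_coneBasis_repr_smul, sum_coneBasis_repr, simplex] using
      sum_smul_mem_smul_convexHull_range (fun i => toReal (v i)) h

theorem mem_interior_simplex {y : Fin n → ℝ} (hy : ∀ i, 0 < (coneBasis hv).repr (y, 1) i) :
    y ∈ interior (simplex v) := by
  refine mem_interior.2 ⟨⋂ i, {y | 0 < (coneBasis hv).repr (y, 1) i}, fun z hz => ?_,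
    isOpen_iInter_of_finite fun i => ?_, by simpa using hy⟩
  · rw [← one_smul ℝ (simplex v), mem_smul_simplex_iff hv zero_le_one]
    exact fun i => (Set.mem_iInter.1 hz i).le
  · have hcont : Continuous ((coneBasis hv).coord i) := LinearMap.continuous_of_finiteDimensional _
    exact isOpen_lt continuous_const (hcont.comp (by fun_prop : Continuous fun y => (y, (1 : ℝ))))

theorem toReal_add (a b : Fin n → ℤ) : toReal (a + b) = toReal a + toReal b := by
  ext i
  simp [toReal]

/-- The coordinates of a lattice point `(a, m)` in the basis `(vᵢ, 1)`. -/
noncomputable def coneCoord (p : (Fin n → ℤ) × ℕ) (i : Fin (n + 1)) : ℝ :=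
  (coneBasis hv).repr (toReal p.1, (p.2 : ℝ)) i

theorem mem_coneMonoid_iff {p : (Fin n → ℤ) × ℕ} :
    p ∈ coneMonoid v ↔ ∀ i, 0 ≤ coneCoord hv p i :=
  mem_smul_simplex_iff hv (Nat.cast_nonneg p.2)

theorem coneCoord_add (p q : (Fin n → ℤ) × ℕ) (i : Fin (n + 1)) :
    coneCoord hv (p + q) i = coneCoord hv p i + coneCoord hv q i := by
  rw [coneCoord, coneCoord, coneCoord, ← Finsupp.add_apply, ← map_add]
  simp [toReal_add]

theorem coneCoord_vertexExponent (i j : Fin (n + 1)) :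
    coneCoord hv (vertexExponent v i) j = if i = j then 1 else 0 := by
  simp only [coneCoord, vertexExponent, Nat.cast_one]
  rw [← coneBasis_apply hv, Module.Basis.repr_self, Finsupp.single_apply]

theorem sum_coneCoord (p : (Fin n → ℤ) × ℕ) : ∑ i, coneCoord hv p i = p.2 :=
  sum_coneBasis_repr hv _ _

variable (v) in
/-- An exponent is reduced if its monomial is not divisible by any vertex monomial `x^{vᵢ} z`. -/
def IsReducedExponent (s : coneMonoid v) : Prop :=
  ∀ i t, s ≠ t + vertexExponent v i

theorem exists_eq_add_vertexExponent (s : coneMonoid v) {i : Fin (n + 1)}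
    (hi : 1 ≤ coneCoord hv s i) : ∃ t, s = t + vertexExponent v i := by
  have hs := (mem_coneMonoid_iff hv).1 s.2
  have hdeg : 1 ≤ s.1.2 := by
    have := hi.trans (Finset.single_le_sum (fun j _ => hs j) (Finset.mem_univ i))
    exact_mod_cast this.trans_eq (sum_coneCoord hv s)
  have hsplit : s.1 = (s.1.1 - v i, s.1.2 - 1) + (vertexExponent v i).1 :=
    Prod.ext (sub_add_cancel _ _).symm (Nat.sub_add_cancel hdeg).symm
  refine ⟨⟨(s.1.1 - v i, s.1.2 - 1), (mem_coneMonoid_iff hv).2 fun j => ?_⟩, Subtype.ext hsplit⟩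
  have hj := hs j
  rw [hsplit, coneCoord_add, coneCoord_vertexExponent] at hj
  split_ifs at hj with hij
  · subst hij
    rw [hsplit, coneCoord_add, coneCoord_vertexExponent, if_pos rfl] at hi
    linarith
  · simpa using hj

theorem isReducedExponent_iff (s : coneMonoid v) :
    IsReducedExponent v s ↔ ∀ i, coneCoord hv s i < 1 := by
  constructor
  · intro hs i
    by_contra! hi
    obtain ⟨t, ht⟩ := exists_eq_add_vertexExponent hv s hi
    exact hs i t ht
  · rintro hs i t rfl
    have hlt := hs i
    rw [AddSubmonoid.coe_add, coneCoord_add, coneCoord_vertexExponent, if_pos rfl] at hlt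
    linarith [(mem_coneMonoid_iff hv).1 t.2 i]

variable (v) in
theorem isIntegrallyClosed_simplex_of_reduced
    (h : ∀ s, IsReducedExponent v s → s.1.2 ≠ 0 → ∃ t r : coneMonoid v, r.1.2 = 1 ∧ s = t + r) :
    IsIntegrallyClosed (simplex v) := by
  have hsummand : ∀ s : coneMonoid v, s.1.2 ≠ 0 →
      ∃ t r : coneMonoid v, r.1.2 = 1 ∧ s = t + r := by
    intro s hs
    by_cases hred : IsReducedExponent v s
    · exact h s hred hs
    · simp only [IsReducedExponent, not_forall, not_not] at hred
      obtain ⟨i, t, rfl⟩ := hred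
      exact ⟨t, vertexExponent v i, rfl, rfl⟩
  refine ⟨isLatticePolytope_convexHull_range v, fun m => ?_⟩
  induction m with
  | zero =>
    intro x hx
    rw [Nat.cast_zero, simplex, Set.zero_smul_set (Set.range_nonempty _).convexHull] at hx
    exact ⟨Fin.elim0, fun j => j.elim0, funext fun j => by simpa [toReal] using congrFun hx j⟩
  | succ m ih =>
    intro x hx
    obtain ⟨t, r, hr, hxtr⟩ := hsummand ⟨(x, m + 1), hx⟩ (Nat.succ_ne_zero m)
    have hx' : x = t.1.1 + r.1.1 := congrArg (fun s => s.1.1) hxtr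
    have ht : t.1.2 = m := by
      have : m + 1 = t.1.2 + r.1.2 := congrArg (fun s => s.1.2) hxtr
      omega
    obtain ⟨y, hy, hsum⟩ := ih t.1.1 (ht ▸ t.2)
    have hrP : toReal r.1.1 ∈ simplex v := by
      have : toReal r.1.1 ∈ (r.1.2 : ℝ) • simplex v := r.2
      simpa [hr] using this
    exact ⟨Fin.cons r.1.1 y, Fin.cons hrP hy, by rw [Fin.sum_cons, ← hsum, hx', add_comm]⟩

end Simplex

/-! ### Reduced monomials in the quotient ring -/

section Quotient

variable {n : ℕ} (v : Fin (n + 1) → Fin n → ℤ)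

/-- The class of the monomial `xᵃ zᵐ`, `s = (a, m)`, in `R v`. -/
noncomputable def quotientMonomial (s : coneMonoid v) : R v :=
  Ideal.Quotient.mk (vertexIdeal v) (monomial v s)

theorem mem_vertexIdeal_iff (f : SemigroupAlgebra v) :
    f ∈ vertexIdeal v ↔ ∀ s ∈ f.coeff.support, ¬ IsReducedExponent v s := by
  have hgen : (Set.range fun i => monomial v (vertexExponent v i)) =
      AddMonoidAlgebra.of' ℂ (coneMonoid v) '' Set.range (vertexExponent v) := by
    rw [← Set.range_comp]
    rfl
  rw [vertexIdeal, hgen, AddMonoidAlgebra.mem_ideal_span_of'_image]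
  simp [IsReducedExponent]

theorem quotientMonomial_add (s t : coneMonoid v) :
    quotientMonomial v (s + t) = quotientMonomial v s * quotientMonomial v t := by
  simp [quotientMonomial, monomial, ← map_mul, AddMonoidAlgebra.single_mul_single]

variable {v} in
theorem quotientMonomial_eq_zero {s : coneMonoid v} (hs : ¬ IsReducedExponent v s) :
    quotientMonomial v s = 0 := by
  rw [quotientMonomial, Ideal.Quotient.eq_zero_iff_mem, mem_vertexIdeal_iff]
  intro t ht
  rwa [show t = s by simpa [monomial] using ht]

theorem linearCombination_quotientMonomial (f : SemigroupAlgebra v) :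
    Finsupp.linearCombination ℂ (quotientMonomial v) f.coeff =
      Ideal.Quotient.mk (vertexIdeal v) f := by
  induction f using AddMonoidAlgebra.induction_linear with
  | zero => simp
  | add f g hf hg => simp [hf, hg]
  | single s c =>
    have hsingle : AddMonoidAlgebra.single s c = c • monomial v s := by simp [monomial]
    rw [AddMonoidAlgebra.coeff_single, Finsupp.linearCombination_single, hsingle]
    rfl

theorem linearIndepOn_quotientMonomial :
    LinearIndepOn ℂ (quotientMonomial v) {s | IsReducedExponent v s} := by
  refine linearIndepOn_iff.2 fun l hl hl0 => Finsupp.support_eq_empty.1 ?_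
  have hmem : AddMonoidAlgebra.ofCoeff l ∈ vertexIdeal v := by
    rw [← Ideal.Quotient.eq_zero_iff_mem, ← linearCombination_quotientMonomial]
    exact hl0
  exact Finset.eq_empty_of_forall_notMem fun s hs => (mem_vertexIdeal_iff v _).1 hmem s hs (hl hs)

theorem gradedPiece_eq_span_reduced (k : ℕ) :
    gradedPiece v k =
      Submodule.span ℂ (quotientMonomial v '' {s | IsReducedExponent v s ∧ s.1.2 = k}) := by
  apply le_antisymm
  · refine Submodule.span_le.2 ?_
    rintro _ ⟨s, hs, rfl⟩
    by_cases hr : IsReducedExponent v s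
    · exact Submodule.subset_span ⟨s, ⟨hr, hs⟩, rfl⟩
    · change quotientMonomial v s ∈ _
      exact (quotientMonomial_eq_zero hr).symm ▸ zero_mem _
  · refine Submodule.span_mono ?_
    rintro _ ⟨s, ⟨_, hs⟩, rfl⟩
    exact ⟨s, hs, rfl⟩

theorem span_reduced_eq_top :
    Submodule.span ℂ (quotientMonomial v '' {s | IsReducedExponent v s}) = ⊤ := by
  refine eq_top_iff.2 fun f _ => ?_
  obtain ⟨f, rfl⟩ := Ideal.Quotient.mk_surjective f
  rw [← linearCombination_quotientMonomial, Finsupp.linearCombination_apply]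
  refine Submodule.sum_mem _ fun s _ => Submodule.smul_mem _ _ ?_
  by_cases hr : IsReducedExponent v s
  · exact Submodule.subset_span ⟨s, hr, rfl⟩
  · exact (quotientMonomial_eq_zero hr).symm ▸ zero_mem _

end Quotient

/-! ### Reflexivity of `Δ_(1,q)` -/

section WeightedSimplex

variable {n : ℕ} (q : Fin n → ℕ)

/-- The vertices `v₀ = (-q₁, …, -qₙ)`, `vⱼ = eⱼ` of the simplex `Δ_(1,q)`. -/
def weightedVertex : Fin (n + 1) → Fin n → ℤ :=
  Fin.cons (fun j => -(q j : ℤ)) fun j => Pi.single j 1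

/-- The sum `N = 1 + q₁ + ⋯ + qₙ` of the weights of `Δ_(1,q)`, its normalized volume. -/
def totalWeight : ℕ := 1 + ∑ j, q j

theorem totalWeight_pos : 0 < totalWeight q := Nat.add_pos_left one_pos _

theorem cast_totalWeight : (totalWeight q : ℝ) = 1 + ∑ j, (q j : ℝ) := by
  simp [totalWeight]

theorem sum_smul_weightedVertex_apply (w : Fin (n + 1) → ℝ) (j : Fin n) :
    (∑ i, w i • toReal (weightedVertex q i)) j = w j.succ - q j * w 0 := by
  have hhead : (w 0 • toReal (weightedVertex q 0)) j = -(q j * w 0) := by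
    simp [weightedVertex, toReal, mul_comm]
  have htail : ∑ k : Fin n, (w k.succ • toReal (weightedVertex q k.succ)) j = w j.succ := by
    simp [weightedVertex, toReal, Pi.single_apply]
  rw [Finset.sum_apply, Fin.sum_univ_succ, hhead, htail, neg_add_eq_sub]

theorem totalWeight_mul_eq (w : Fin (n + 1) → ℝ) :
    totalWeight q * w 0 = ∑ i, w i - ∑ j, (∑ i, w i • toReal (weightedVertex q i)) j := by
  simp only [sum_smul_weightedVertex_apply, Finset.sum_sub_distrib, ← Finset.sum_mul,
    cast_totalWeight, Fin.sum_univ_succ w]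
  ring

theorem affineIndependent_weightedVertex :
    AffineIndependent ℝ fun i => toReal (weightedVertex q i) := by
  refine (affineIndependent_iff_of_fintype ℝ _).2 fun w hw hwv => ?_
  rw [Finset.univ.weightedVSub_eq_linear_combination hw] at hwv
  have hzero : w 0 = 0 := by
    have h := totalWeight_mul_eq q w
    rw [hw, hwv] at h
    simpa [(totalWeight_pos q).ne'] using h
  refine Fin.cases hzero fun j => ?_
  have h := sum_smul_weightedVertex_apply q w j
  rw [hwv, hzero] at h
  simpa [eq_comm] using h

theorem coneBasis_weightedVertex_repr_zero (y : Fin n → ℝ) (c : ℝ) :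
    (coneBasis (affineIndependent_weightedVertex q)).repr (y, c) 0 =
      (c - ∑ j, y j) / totalWeight q := by
  have h := totalWeight_mul_eq q
    ((coneBasis (affineIndependent_weightedVertex q)).repr (y, c))
  rw [sum_coneBasis_repr, sum_coneBasis_repr_smul] at h
  rw [eq_div_iff (Nat.cast_ne_zero.2 (totalWeight_pos q).ne'), mul_comm, h]

theorem coneBasis_weightedVertex_repr_succ (y : Fin n → ℝ) (c : ℝ) (j : Fin n) :
    (coneBasis (affineIndependent_weightedVertex q)).repr (y, c) j.succ =
      y j + q j * ((c - ∑ j, y j) / totalWeight q) := by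
  have h := sum_smul_weightedVertex_apply q
    ((coneBasis (affineIndependent_weightedVertex q)).repr (y, c)) j
  rw [sum_coneBasis_repr_smul, coneBasis_weightedVertex_repr_zero] at h
  linarith

theorem weight_weightedVertex_zero : weight (weightedVertex q) 0 = 1 := by
  have hone : (Matrix.of fun j => weightedVertex q ((0 : Fin (n + 1)).succAbove j)) = 1 := by
    ext i j
    simp [weightedVertex, Matrix.one_apply, Pi.single_apply, eq_comm]
  rw [weight, hone, Matrix.det_one, Int.natAbs_one]

theorem weight_weightedVertex_succ (i : Fin n) : weight (weightedVertex q) i.succ = q i := by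
  obtain ⟨n, rfl⟩ := Nat.exists_eq_succ_of_ne_zero i.pos.ne'
  rw [weight, Matrix.det_succ_row_zero, Finset.sum_eq_single i]
  · have hminor : (Matrix.of fun j : Fin (n + 1) => weightedVertex q
        (i.succ.succAbove j)).submatrix Fin.succ i.succAbove = 1 := by
      ext a b
      simp [Fin.succ_succAbove_succ, weightedVertex, Matrix.one_apply, Pi.single_apply, eq_comm]
    rw [hminor]
    simp [weightedVertex, Int.natAbs_mul, Int.natAbs_pow]
  · intro j _ hj
    obtain ⟨a, ha⟩ := Fin.exists_succAbove_eq hj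
    rw [Matrix.det_eq_zero_of_row_eq_zero a, mul_zero]
    intro b
    simp [Fin.succ_succAbove_succ, weightedVertex, ha, Fin.succAbove_ne]
  · simp

theorem hasType_weightedVertex : HasType (weightedVertex q) (Fin.cons 1 q) 1 := by
  refine ⟨?_, Fin.cases ?_ fun j => ?_⟩
  · have hdvd := Finset.gcd_dvd (f := weight (weightedVertex q)) (Finset.mem_univ 0)
    rw [weight_weightedVertex_zero] at hdvd
    exact (Nat.dvd_one.1 hdvd).symm
  · simp [weight_weightedVertex_zero]
  · simp [weight_weightedVertex_succ]

variable {q} in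
theorem pos_of_dvd_totalWeight (hq : ∀ j, q j ∣ totalWeight q) (j : Fin n) : 0 < q j :=
  Nat.pos_of_dvd_of_pos (hq j) (totalWeight_pos q)

theorem zero_mem_interior_simplex_weightedVertex (hq : ∀ j, 0 < q j) :
    0 ∈ interior (simplex (weightedVertex q)) := by
  have hN : (0 : ℝ) < totalWeight q := Nat.cast_pos.2 (totalWeight_pos q)
  refine mem_interior_simplex (affineIndependent_weightedVertex q) (Fin.cases ?_ fun j => ?_)
  · simp [coneBasis_weightedVertex_repr_zero, hN]
  · simp [coneBasis_weightedVertex_repr_succ, hN, hq j]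

theorem mem_polarDual_simplex_weightedVertex_iff {y : Fin n → ℝ} :
    y ∈ polarDual (simplex (weightedVertex q)) ↔ -∑ j, q j * y j ≤ 1 ∧ ∀ j, y j ≤ 1 := by
  rw [simplex, mem_polarDual_convexHull_iff, Set.forall_mem_range, Fin.forall_fin_succ]
  simp [weightedVertex, toReal, dotProduct, Pi.single_apply]

/-- The points `(1, …, 1)` and `(1, …, 1) - (N / qⱼ) eⱼ`. When every `qⱼ` divides `N`, they are the
vertices of the polar dual of `Δ_(1,q)`. -/
def dualVertex : Fin (n + 1) → Fin n → ℤ :=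
  Fin.cons 1 fun j => 1 - Pi.single j (totalWeight q / q j : ℤ)

theorem sum_smul_dualVertex_apply (w : Fin (n + 1) → ℝ) (j : Fin n) :
    (∑ i, w i • toReal (dualVertex q i)) j =
      ∑ i, w i - w j.succ * (totalWeight q / q j : ℤ) := by
  have hhead : (w 0 • toReal (dualVertex q 0)) j = w 0 := by simp [dualVertex, toReal]
  have htail : ∑ k : Fin n, (w k.succ • toReal (dualVertex q k.succ)) j =
      ∑ k : Fin n, w k.succ - w j.succ * (totalWeight q / q j : ℤ) := by
    simp [dualVertex, toReal, Pi.single_apply, mul_sub, Finset.sum_sub_distrib]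
  rw [Finset.sum_apply, Fin.sum_univ_succ, hhead, htail, Fin.sum_univ_succ w, add_sub_assoc]

variable {q}

theorem mul_totalWeight_div (hq : ∀ j, q j ∣ totalWeight q) (j : Fin n) :
    (q j : ℝ) * (totalWeight q / q j : ℤ) = totalWeight q := by
  exact_mod_cast Int.mul_ediv_cancel' (Int.natCast_dvd_natCast.2 (hq j))

theorem dualVertex_mem_polarDual (hq : ∀ j, q j ∣ totalWeight q) (i : Fin (n + 1)) :
    toReal (dualVertex q i) ∈ polarDual (simplex (weightedVertex q)) := by
  rw [mem_polarDual_simplex_weightedVertex_iff]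
  refine Fin.cases ⟨?_, ?_⟩ (fun j => ⟨?_, fun k => ?_⟩) i
  · simp only [dualVertex, toReal, Fin.cons_zero, Pi.one_apply, Int.cast_one, mul_one]
    linarith [cast_totalWeight q]
  · simp [dualVertex, toReal]
  · have hpair : ∑ k, (q k : ℝ) * toReal (dualVertex q j.succ) k =
        ∑ k, (q k : ℝ) - q j * (totalWeight q / q j : ℤ) := by
      simp [dualVertex, toReal, mul_sub, Finset.sum_sub_distrib, Pi.single_apply]
    rw [hpair, mul_totalWeight_div hq, cast_totalWeight]
    linarith
  · have hnonneg : (0 : Fin n → ℤ) ≤ Pi.single j (totalWeight q / q j : ℤ) :=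
      Pi.single_nonneg.2 (by positivity)
    have hle : dualVertex q j.succ k ≤ 1 := sub_le_self 1 (hnonneg k)
    change (dualVertex q j.succ k : ℝ) ≤ 1
    exact_mod_cast hle

theorem polarDual_simplex_weightedVertex (hq : ∀ j, q j ∣ totalWeight q) :
    polarDual (simplex (weightedVertex q)) =
      convexHull ℝ (Set.range fun i => toReal (dualVertex q i)) := by
  have hN : (0 : ℝ) < totalWeight q := Nat.cast_pos.2 (totalWeight_pos q)
  refine Set.Subset.antisymm (fun y hy => ?_) (convexHull_min
    (Set.range_subset_iff.2 (dualVertex_mem_polarDual hq)) (convex_polarDual _))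
  obtain ⟨h0, h1⟩ := (mem_polarDual_simplex_weightedVertex_iff q).1 hy
  let w : Fin (n + 1) → ℝ := Fin.cons ((1 + ∑ j, q j * y j) / totalWeight q)
    fun j => q j * (1 - y j) / totalWeight q
  have hw : ∀ i, 0 ≤ w i := Fin.cases (div_nonneg (by linarith) hN.le) fun j =>
    div_nonneg (mul_nonneg (Nat.cast_nonneg _) (sub_nonneg.2 (h1 j))) hN.le
  have hsum : ∑ i, w i = 1 := by
    simp only [w, Fin.sum_univ_succ, Fin.cons_zero, Fin.cons_succ, ← Finset.sum_div, mul_sub,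
      mul_one, Finset.sum_sub_distrib]
    rw [← add_div, div_eq_one_iff_eq hN.ne', cast_totalWeight]
    ring
  have hwy : ∑ i, w i • toReal (dualVertex q i) = y := by
    ext j
    rw [sum_smul_dualVertex_apply, hsum]
    simp only [w, Fin.cons_succ]
    rw [div_mul_eq_mul_div, mul_right_comm, mul_totalWeight_div hq,
      mul_div_cancel_left₀ _ hN.ne', sub_sub_cancel]
  simpa only [hsum, one_smul, hwy] using
    sum_smul_mem_smul_convexHull_range (fun i => toReal (dualVertex q i)) hw

theorem isReflexive_simplex_weightedVertex (hq : ∀ j, q j ∣ totalWeight q) :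
    IsReflexive (simplex (weightedVertex q)) :=
  ⟨isLatticePolytope_convexHull_range _,
    zero_mem_interior_simplex_weightedVertex q (pos_of_dvd_totalWeight hq),
    polarDual_simplex_weightedVertex hq ▸ isLatticePolytope_convexHull_range _⟩

variable (q)

/-! ### Lattice points of the half-open parallelepiped of `Δ_(1,q)` -/

/-- The degree of the box point of `Δ_(1,q)` with index `t`; the subtraction does not truncate. -/
def boxDegree (t : ℕ) : ℕ := t - ∑ j, q j * t / totalWeight q

theorem sum_mul_div_totalWeight_le (t : ℕ) : ∑ j, q j * t / totalWeight q ≤ t := by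
  refine Nat.le_of_mul_le_mul_left ?_ (totalWeight_pos q)
  calc totalWeight q * ∑ j, q j * t / totalWeight q
      = ∑ j, totalWeight q * (q j * t / totalWeight q) := Finset.mul_sum ..
    _ ≤ ∑ j, q j * t := Finset.sum_le_sum fun j _ => Nat.mul_div_le _ _
    _ = (∑ j, q j) * t := (Finset.sum_mul ..).symm
    _ ≤ totalWeight q * t := Nat.mul_le_mul_right t (Nat.le_add_left _ 1)

theorem boxDegree_add_sum (t : ℕ) : boxDegree q t + ∑ j, q j * t / totalWeight q = t :=
  Nat.sub_add_cancel (sum_mul_div_totalWeight_le q t)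

/-- The lattice point whose coordinates in the basis `(vᵢ, 1)` are `t / N` at `v₀` and the
fractional part of `qⱼ t / N` at `vⱼ`. For `t < N` these are the lattice points of the half-open
parallelepiped spanned by the vectors `(vᵢ, 1)`. -/
def boxPoint (t : ℕ) : (Fin n → ℤ) × ℕ :=
  (fun j => -(q j * t / totalWeight q : ℕ), boxDegree q t)

theorem coneCoord_weightedVertex_zero (p : (Fin n → ℤ) × ℕ) :
    coneCoord (affineIndependent_weightedVertex q) p 0 =
      ((p.2 - ∑ j, p.1 j : ℤ) : ℝ) / totalWeight q := by
  simp [coneCoord, coneBasis_weightedVertex_repr_zero, toReal]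

theorem coneCoord_weightedVertex_succ (p : (Fin n → ℤ) × ℕ) (j : Fin n) :
    coneCoord (affineIndependent_weightedVertex q) p j.succ =
      ((totalWeight q * p.1 j + q j * (p.2 - ∑ k, p.1 k) : ℤ) : ℝ) / totalWeight q := by
  have hN : (totalWeight q : ℝ) ≠ 0 := Nat.cast_ne_zero.2 (totalWeight_pos q).ne'
  simp only [coneCoord, coneBasis_weightedVertex_repr_succ, toReal]
  push_cast
  field_simp

theorem boxPoint_snd_sub_sum (t : ℕ) :
    ((boxPoint q t).2 - ∑ j, (boxPoint q t).1 j : ℤ) = t := by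
  simp only [boxPoint, Finset.sum_neg_distrib, sub_neg_eq_add]
  exact_mod_cast boxDegree_add_sum q t

theorem coneCoord_boxPoint_zero (t : ℕ) :
    coneCoord (affineIndependent_weightedVertex q) (boxPoint q t) 0 = t / totalWeight q := by
  rw [coneCoord_weightedVertex_zero, boxPoint_snd_sub_sum, Int.cast_natCast]

theorem coneCoord_boxPoint_succ (t : ℕ) (j : Fin n) :
    coneCoord (affineIndependent_weightedVertex q) (boxPoint q t) j.succ =
      (q j * t % totalWeight q : ℕ) / totalWeight q := by
  have hmod : (totalWeight q * (boxPoint q t).1 j + q j * t : ℤ) =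
      (q j * t % totalWeight q : ℕ) := by
    have h : ((totalWeight q * (q j * t / totalWeight q) + q j * t % totalWeight q : ℕ) : ℤ) =
        (q j * t : ℕ) := congrArg Nat.cast (Nat.div_add_mod (q j * t) (totalWeight q))
    simp only [boxPoint]
    push_cast at h ⊢
    linarith
  rw [coneCoord_weightedVertex_succ, boxPoint_snd_sub_sum, hmod, Int.cast_natCast]

/-- The box point with index `t`, as an exponent of the semigroup algebra. -/
def boxExponent (t : ℕ) : coneMonoid (weightedVertex q) :=
  ⟨boxPoint q t, (mem_coneMonoid_iff (affineIndependent_weightedVertex q)).2 <|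
    Fin.cases (by rw [coneCoord_boxPoint_zero]; positivity)
      fun j => by rw [coneCoord_boxPoint_succ]; positivity⟩

theorem isReducedExponent_boxExponent_iff {t : ℕ} :
    IsReducedExponent (weightedVertex q) (boxExponent q t) ↔ t < totalWeight q := by
  have hN : (0 : ℝ) < totalWeight q := Nat.cast_pos.2 (totalWeight_pos q)
  rw [isReducedExponent_iff (affineIndependent_weightedVertex q), Fin.forall_fin_succ]
  simp only [boxExponent, coneCoord_boxPoint_zero, coneCoord_boxPoint_succ, div_lt_one hN,
    Nat.cast_lt, Nat.mod_lt _ (totalWeight_pos q), implies_true, and_true]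

theorem boxExponent_injective : Function.Injective (boxExponent q) := by
  intro s t hst
  have h := coneCoord_boxPoint_zero q s
  rw [show boxPoint q s = boxPoint q t from congrArg Subtype.val hst, coneCoord_boxPoint_zero,
    div_left_inj' (Nat.cast_ne_zero.2 (totalWeight_pos q).ne'), Nat.cast_inj] at h
  exact h.symm

variable {q}

theorem exists_boxExponent_eq {s : coneMonoid (weightedVertex q)}
    (hs : IsReducedExponent (weightedVertex q) s) :
    ∃ t : ℕ, t < totalWeight q ∧ boxExponent q t = s := by
  have hN : (0 : ℝ) < totalWeight q := Nat.cast_pos.2 (totalWeight_pos q)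
  have hnonneg := (mem_coneMonoid_iff (affineIndependent_weightedVertex q)).1 s.2
  have hlt := (isReducedExponent_iff (affineIndependent_weightedVertex q) s).1 hs
  obtain ⟨t, ht⟩ : ∃ t : ℕ, (s.1.2 : ℤ) - ∑ j, s.1.1 j = t := by
    refine Int.eq_ofNat_of_zero_le ?_
    have h0 := hnonneg 0
    rw [coneCoord_weightedVertex_zero, le_div_iff₀ hN, zero_mul] at h0
    exact_mod_cast h0
  have hdiv : ∀ j, ((q j * t / totalWeight q : ℕ) : ℤ) = -s.1.1 j := by
    intro j
    have h0 := hnonneg j.succ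
    have h1 := hlt j.succ
    rw [coneCoord_weightedVertex_succ, ht, le_div_iff₀ hN, zero_mul] at h0
    rw [coneCoord_weightedVertex_succ, ht, div_lt_one hN] at h1
    push_cast
    exact ((Int.ediv_emod_unique (r := totalWeight q * s.1.1 j + q j * t)
      (Int.natCast_pos.2 (totalWeight_pos q))).2
      ⟨by ring, by exact_mod_cast h0, by exact_mod_cast h1⟩).1
  have hst : boxExponent q t = s := by
    refine Subtype.ext (Prod.ext (funext fun j => ?_) ?_)
    · exact neg_eq_iff_eq_neg.2 (hdiv j)
    · have hdeg : (boxDegree q t : ℤ) + ∑ j, ((q j * t / totalWeight q : ℕ) : ℤ) = t := by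
        exact_mod_cast boxDegree_add_sum q t
      rw [Finset.sum_congr rfl fun j _ => hdiv j, Finset.sum_neg_distrib] at hdeg
      change boxDegree q t = s.1.2
      omega
  exact ⟨t, (isReducedExponent_boxExponent_iff q).1 (hst ▸ hs), hst⟩

theorem boxExponent_add {r s : ℕ}
    (h : boxDegree q (r + s) = boxDegree q r + boxDegree q s) :
    boxExponent q (r + s) = boxExponent q r + boxExponent q s := by
  have hle : ∀ j ∈ Finset.univ, q j * r / totalWeight q + q j * s / totalWeight q ≤
      q j * (r + s) / totalWeight q := fun j _ => by
    rw [mul_add]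
    exact Nat.div_add_div_le_add_div
  have hsum : ∑ j, (q j * r / totalWeight q + q j * s / totalWeight q) =
      ∑ j, q j * (r + s) / totalWeight q := by
    rw [Finset.sum_add_distrib]
    have hr := boxDegree_add_sum q r
    have hs := boxDegree_add_sum q s
    have hrs := boxDegree_add_sum q (r + s)
    omega
  have hterm := (Finset.sum_eq_sum_iff_of_le hle).1 hsum
  refine Subtype.ext (Prod.ext (funext fun j => ?_) h)
  change -((q j * (r + s) / totalWeight q : ℕ) : ℤ) =
    -((q j * r / totalWeight q : ℕ) : ℤ) + -((q j * s / totalWeight q : ℕ) : ℤ)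
  rw [← hterm j (Finset.mem_univ j)]
  push_cast
  ring

theorem index_eq_add_of_boxExponent_add_eq {r s u : ℕ}
    (h : boxExponent q r + boxExponent q s = boxExponent q u) : r + s = u := by
  have hcoord := coneCoord_boxPoint_zero q u
  rw [show boxPoint q u = boxPoint q r + boxPoint q s from congrArg Subtype.val h.symm,
    coneCoord_add, coneCoord_boxPoint_zero, coneCoord_boxPoint_zero, ← add_div,
    div_left_inj' (Nat.cast_ne_zero.2 (totalWeight_pos q).ne')] at hcoord
  exact_mod_cast hcoord

theorem isIntegrallyClosed_simplex_weightedVertex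
    (h : ∀ t < totalWeight q, boxDegree q t ≠ 0 →
      ∃ r s, r + s = t ∧ boxDegree q r = 1 ∧ boxDegree q t = boxDegree q r + boxDegree q s) :
    IsIntegrallyClosed (simplex (weightedVertex q)) := by
  refine isIntegrallyClosed_simplex_of_reduced _ fun s hs hdeg => ?_
  obtain ⟨t, ht, rfl⟩ := exists_boxExponent_eq hs
  obtain ⟨r, s, rfl, hr, hadd⟩ := h t ht hdeg
  exact ⟨boxExponent q s, boxExponent q r, hr, by rw [boxExponent_add hadd, add_comm]⟩

variable (q) in
/-- The class in `R` of the monomial of the box point with index `t`. -/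
noncomputable def boxMonomial (t : ℕ) : R (weightedVertex q) :=
  quotientMonomial (weightedVertex q) (boxExponent q t)

variable (q) in
/-- The indices of the box points of degree `k`. -/
def boxIndices (k : ℕ) : Finset ℕ := {t ∈ Finset.range (totalWeight q) | boxDegree q t = k}

theorem mem_boxIndices {k t : ℕ} :
    t ∈ boxIndices q k ↔ t < totalWeight q ∧ boxDegree q t = k := by
  simp [boxIndices]

variable (q) in
theorem linearIndepOn_boxMonomial :
    LinearIndepOn ℂ (boxMonomial q) (Finset.range (totalWeight q)) := by
  refine LinearIndepOn.comp_of_image (f := boxExponent q)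
    ((linearIndepOn_quotientMonomial _).mono ?_) (boxExponent_injective q).injOn
  rintro _ ⟨t, ht, rfl⟩
  exact (isReducedExponent_boxExponent_iff q).2 (Finset.mem_range.1 ht)

theorem finrank_span_boxMonomial {S : Finset ℕ} (hS : S ⊆ Finset.range (totalWeight q)) :
    Module.finrank ℂ (Submodule.span ℂ (boxMonomial q '' S)) = S.card := by
  have hli : LinearIndepOn ℂ (boxMonomial q) S := (linearIndepOn_boxMonomial q).mono hS
  rw [Set.image_eq_range]
  exact (finrank_span_eq_card hli).trans (Fintype.card_coe S)

variable (q) in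
theorem gradedPiece_eq_span_boxMonomial (k : ℕ) :
    gradedPiece (weightedVertex q) k =
      Submodule.span ℂ (boxMonomial q '' (boxIndices q k : Set ℕ)) := by
  rw [gradedPiece_eq_span_reduced]
  congr 1
  ext f
  constructor
  · rintro ⟨s, ⟨hs, hk⟩, rfl⟩
    obtain ⟨t, ht, rfl⟩ := exists_boxExponent_eq hs
    exact ⟨t, mem_boxIndices.2 ⟨ht, hk⟩, rfl⟩
  · rintro ⟨t, ht, rfl⟩
    obtain ⟨ht, hk⟩ := mem_boxIndices.1 ht
    exact ⟨boxExponent q t, ⟨(isReducedExponent_boxExponent_iff q).2 ht, hk⟩, rfl⟩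

variable (q) in
theorem finrank_gradedPiece (k : ℕ) :
    Module.finrank ℂ (gradedPiece (weightedVertex q) k) = (boxIndices q k).card := by
  rw [gradedPiece_eq_span_boxMonomial]
  exact finrank_span_boxMonomial (Finset.filter_subset _ _)

instance finite_R_weightedVertex : Module.Finite ℂ (R (weightedVertex q)) := by
  refine ⟨Submodule.fg_def.2 ⟨boxMonomial q '' (Finset.range (totalWeight q)),
    (Finset.finite_toSet _).image _, ?_⟩⟩
  rw [eq_top_iff, ← span_reduced_eq_top]
  refine Submodule.span_mono ?_
  rintro _ ⟨s, hs, rfl⟩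
  obtain ⟨t, ht, rfl⟩ := exists_boxExponent_eq hs
  exact ⟨t, Finset.mem_coe.2 (Finset.mem_range.2 ht), rfl⟩

theorem boxMonomial_mul_eq_zero_or (s t : ℕ) :
    boxMonomial q s * boxMonomial q t = 0 ∨
      boxMonomial q s * boxMonomial q t = boxMonomial q (s + t) ∧
        s + t ∈ boxIndices q (boxDegree q s + boxDegree q t) := by
  simp only [boxMonomial, ← quotientMonomial_add]
  by_cases hred : IsReducedExponent (weightedVertex q) (boxExponent q s + boxExponent q t)
  · obtain ⟨u, hu, hadd⟩ := exists_boxExponent_eq hred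
    obtain rfl := index_eq_add_of_boxExponent_add_eq hadd.symm
    exact Or.inr ⟨by rw [hadd], mem_boxIndices.2 ⟨hu, congrArg (fun s => s.1.2) hadd⟩⟩
  · exact Or.inl (quotientMonomial_eq_zero hred)

end WeightedSimplex

theorem not_injective_mulMap_of_finrank_lt {n : ℕ} {v : Fin (n + 1) → Fin n → ℤ} {k : ℕ}
    {l : gradedPiece v 1} {W U : Submodule ℂ (R v)} [Module.Finite ℂ U] (hW : W ≤ gradedPiece v k)
    (hWU : ∀ f ∈ W, (l : R v) * f ∈ U) (hlt : Module.finrank ℂ U < Module.finrank ℂ W) :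
    ¬ Function.Injective (mulMap v l k) := by
  intro hinj
  have hrestrict : Function.Injective ((LinearMap.mulLeft ℂ (l : R v)).restrict hWU) := by
    intro f g hfg
    have hmul : (l : R v) * f = l * g := congrArg Subtype.val hfg
    have hfg' : (⟨f, hW f.2⟩ : gradedPiece v k) = ⟨g, hW g.2⟩ := hinj (Subtype.ext hmul)
    exact Subtype.ext (Subtype.mk.inj hfg')
  exact (LinearMap.finrank_le_finrank_of_injective hrestrict).not_gt hlt

/-! ### The weights `(1, d, d + 1, …, d + 1)` -/

section VertexQ

variable {d : ℕ}

/-- The weights `(d, d+1, …, d+1)` of `Q` other than the leading `1`. -/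
def tailQ (d : ℕ) (j : Fin d) : ℕ := if (j : ℕ) = 0 then d else d + 1

theorem weightQ_eq_cons (d : ℕ) : weightQ d = Fin.cons 1 (tailQ d) := by
  ext i
  refine Fin.cases ?_ (fun j => ?_) i <;> simp [weightQ, tailQ]

theorem vertexQ_eq_weightedVertex (d : ℕ) : vertexQ d = weightedVertex (tailQ d) := by
  have hcast : (fun j : Fin d => if (j : ℕ) = 0 then -(d : ℤ) else -(d : ℤ) - 1) =
      fun j => -(tailQ d j : ℤ) := by
    ext j
    rw [tailQ]
    split_ifs <;> push_cast <;> ring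
  rw [vertexQ, hcast, weightedVertex]

theorem sum_tailQ (hd : 0 < d) (f : ℕ → ℕ) : ∑ j, f (tailQ d j) = f d + (d - 1) * f (d + 1) := by
  obtain ⟨n, rfl⟩ := Nat.exists_eq_add_one.2 hd
  simp [Fin.sum_univ_succ, tailQ]

theorem totalWeight_tailQ (hd : 0 < d) : totalWeight (tailQ d) = d * (d + 1) := by
  rw [totalWeight, sum_tailQ hd fun x => x]
  obtain ⟨n, rfl⟩ := Nat.exists_eq_add_one.2 hd
  simp only [Nat.add_sub_cancel]
  ring

theorem tailQ_dvd_totalWeight (j : Fin d) : tailQ d j ∣ totalWeight (tailQ d) := by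
  rw [totalWeight_tailQ j.pos, tailQ]
  split_ifs
  · exact dvd_mul_right ..
  · exact dvd_mul_left ..

theorem exists_eq_mul_add {t : ℕ} (ht : t < totalWeight (tailQ d)) (hd : 0 < d) :
    ∃ k ≤ d, ∃ b < d, t = d * k + b := by
  rw [totalWeight_tailQ hd] at ht
  exact ⟨t / d, Nat.lt_succ_iff.1 (Nat.div_lt_of_lt_mul ht), t % d, Nat.mod_lt t hd,
    (Nat.div_add_mod t d).symm⟩

theorem mul_add_lt_totalWeight_iff {k b : ℕ} (hb : b < d) :
    d * k + b < totalWeight (tailQ d) ↔ k ≤ d := by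
  have hd : 0 < d := Nat.zero_lt_of_lt hb
  rw [totalWeight_tailQ hd, mul_comm d (d + 1), ← Nat.div_lt_iff_lt_mul hd, Nat.mul_add_div hd,
    Nat.div_eq_of_lt hb, add_zero, Nat.lt_succ_iff]

theorem boxDegree_tailQ {k b : ℕ} (hk : k ≤ d) (hb : b < d) :
    boxDegree (tailQ d) (d * k + b) = b + if b < k then 1 else 0 := by
  have hd : 0 < d := Nat.zero_lt_of_lt hb
  have hdiv : (d * k + b) / d = k := by
    rw [Nat.mul_add_div hd, Nat.div_eq_of_lt hb, add_zero]
  have hdiv' : (d * k + b) / (d + 1) + (if b < k then 1 else 0) = k := by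
    split_ifs with hbk
    · obtain ⟨m, rfl⟩ := Nat.exists_eq_add_one_of_ne_zero (Nat.ne_zero_of_lt hbk)
      rw [Nat.div_eq_of_lt_le (k := m)] <;> grind
    · rw [Nat.div_eq_of_lt_le (k := k)] <;> grind
  have hsum : ∑ j, tailQ d j * (d * k + b) / totalWeight (tailQ d) =
      (d * k + b) / (d + 1) + (d - 1) * k := by
    rw [totalWeight_tailQ hd, sum_tailQ hd fun x => x * (d * k + b) / (d * (d + 1)),
      Nat.mul_div_mul_left _ _ hd, mul_comm d (d + 1), Nat.mul_div_mul_left _ _ d.succ_pos, hdiv]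
  have hadd := boxDegree_add_sum (tailQ d) (d * k + b)
  have hdk : k + (d - 1) * k = d * k := by
    rw [add_comm, ← Nat.succ_mul, Nat.succ_eq_add_one, Nat.sub_add_cancel hd]
  rw [hsum] at hadd
  omega

theorem isIntegrallyClosed_simplex_tailQ (hd : 0 < d) :
    IsIntegrallyClosed (simplex (weightedVertex (tailQ d))) := by
  refine isIntegrallyClosed_simplex_weightedVertex fun t ht hdeg => ?_
  obtain ⟨k, hk, b, hb, rfl⟩ := exists_eq_mul_add ht hd
  rw [boxDegree_tailQ hk hb] at hdeg
  obtain ⟨k₁, k₂, b₁, b₂, rfl, rfl, hone, hadd⟩ : ∃ k₁ k₂ b₁ b₂, k₁ + k₂ = k ∧ b₁ + b₂ = b ∧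
      (b₁ + if b₁ < k₁ then 1 else 0) = 1 ∧
      (b + if b < k then 1 else 0) = 1 + (b₂ + if b₂ < k₂ then 1 else 0) := by
    rcases Nat.eq_zero_or_pos b with rfl | hb0
    · exact ⟨k, 0, 0, 0, by grind⟩
    rcases Nat.eq_zero_or_pos k with rfl | hk0
    · exact ⟨0, 0, 1, b - 1, by grind⟩
    · exact ⟨1, k - 1, 1, b - 1, by grind⟩
  have h₁ := boxDegree_tailQ (Nat.le_of_add_right_le hk) (Nat.lt_of_add_right_lt hb)
  have h₂ := boxDegree_tailQ (Nat.le_of_add_left_le hk) (Nat.lt_of_add_left_lt hb)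
  refine ⟨d * k₁ + b₁, d * k₂ + b₂, by ring, h₁.trans hone, ?_⟩
  rw [boxDegree_tailQ hk hb, h₁, h₂, hadd, hone]

/-- The span of the degree-one box monomials with indices `d, 2d, …, d²`. -/
noncomputable def multipleSpan (d : ℕ) : Submodule ℂ (R (weightedVertex (tailQ d))) :=
  Submodule.span ℂ (boxMonomial (tailQ d) '' ((Finset.Icc 1 d).image (d * ·) : Finset ℕ))

/-- The span of the degree-two box monomials with indices `2d + 1, 3d + 1, …, d² + 1`. -/
noncomputable def succMultipleSpan (d : ℕ) : Submodule ℂ (R (weightedVertex (tailQ d))) :=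
  Submodule.span ℂ (boxMonomial (tailQ d) '' ((Finset.Icc 2 d).image (d * · + 1) : Finset ℕ))

theorem finrank_multipleSpan (hd : 0 < d) : Module.finrank ℂ (multipleSpan d) = d := by
  rw [multipleSpan, finrank_span_boxMonomial, Finset.card_image_of_injective, Nat.card_Icc]
  · simp
  · exact fun a b hab => Nat.eq_of_mul_eq_mul_left hd hab
  · intro t ht
    obtain ⟨k, hk, rfl⟩ := Finset.mem_image.1 ht
    exact Finset.mem_range.2 ((mul_add_lt_totalWeight_iff hd).2 (Finset.mem_Icc.1 hk).2)

theorem finrank_succMultipleSpan (hd : 1 < d) :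
    Module.finrank ℂ (succMultipleSpan d) = d - 1 := by
  rw [succMultipleSpan, finrank_span_boxMonomial, Finset.card_image_of_injective, Nat.card_Icc]
  · omega
  · exact fun a b hab => Nat.eq_of_mul_eq_mul_left (Nat.zero_lt_of_lt hd) (Nat.succ_injective hab)
  · intro t ht
    obtain ⟨k, hk, rfl⟩ := Finset.mem_image.1 ht
    exact Finset.mem_range.2 ((mul_add_lt_totalWeight_iff hd).2 (Finset.mem_Icc.1 hk).2)

theorem image_mul_subset_boxIndices (hd : 0 < d) :
    (Finset.Icc 1 d).image (d * ·) ⊆ boxIndices (tailQ d) 1 := by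
  intro t ht
  obtain ⟨k, hk, rfl⟩ := Finset.mem_image.1 ht
  obtain ⟨hk0, hkd⟩ := Finset.mem_Icc.1 hk
  refine mem_boxIndices.2 ⟨(mul_add_lt_totalWeight_iff hd).2 hkd, ?_⟩
  simpa [Nat.lt_of_succ_le hk0] using boxDegree_tailQ hkd hd

theorem multipleSpan_le_gradedPiece (hd : 0 < d) :
    multipleSpan d ≤ gradedPiece (weightedVertex (tailQ d)) 1 := by
  rw [gradedPiece_eq_span_boxMonomial]
  exact Submodule.span_mono (Set.image_mono (Finset.coe_subset.2 (image_mul_subset_boxIndices hd)))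

theorem boxMonomial_mul_mem_succMultipleSpan (hd : 0 < d) {s t : ℕ}
    (hs : s ∈ boxIndices (tailQ d) 1) (ht : t ∈ (Finset.Icc 1 d).image (d * ·)) :
    boxMonomial (tailQ d) s * boxMonomial (tailQ d) t ∈ succMultipleSpan d := by
  obtain ⟨hsN, hs1⟩ := mem_boxIndices.1 hs
  obtain ⟨_, ht1⟩ := mem_boxIndices.1 (image_mul_subset_boxIndices hd ht)
  rcases boxMonomial_mul_eq_zero_or (q := tailQ d) s t with hzero | ⟨hmul, hst⟩
  · exact hzero ▸ zero_mem _
  obtain ⟨k, hk, b, hb, rfl⟩ := exists_eq_mul_add hsN hd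
  obtain ⟨m, hm, rfl⟩ := Finset.mem_image.1 ht
  obtain ⟨hstN, hst2⟩ := mem_boxIndices.1 hst
  have hsum : d * k + b + d * m = d * (k + m) + b := by ring
  rw [hsum] at hstN hst2
  have hkm : k + m ≤ d := (mul_add_lt_totalWeight_iff hb).1 hstN
  rw [hs1, ht1, boxDegree_tailQ hkm hb] at hst2
  rw [boxDegree_tailQ hk hb] at hs1
  obtain ⟨rfl, hkm2⟩ : b = 1 ∧ 2 ≤ k + m := by grind
  rw [hmul, hsum]
  exact Submodule.subset_span ⟨_, Finset.mem_coe.2 (Finset.mem_image.2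
    ⟨k + m, Finset.mem_Icc.2 ⟨hkm2, hkm⟩, rfl⟩), rfl⟩

theorem mul_mem_succMultipleSpan (hd : 0 < d) {l f : R (weightedVertex (tailQ d))}
    (hl : l ∈ gradedPiece (weightedVertex (tailQ d)) 1) (hf : f ∈ multipleSpan d) :
    l * f ∈ succMultipleSpan d := by
  rw [gradedPiece_eq_span_boxMonomial] at hl
  have hlf := Submodule.mul_mem_mul hl hf
  rw [multipleSpan, Submodule.span_mul_span] at hlf
  refine Submodule.span_le.2 ?_ hlf
  rintro _ ⟨_, ⟨s, hs, rfl⟩, _, ⟨t, ht, rfl⟩, rfl⟩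
  exact boxMonomial_mul_mem_succMultipleSpan hd hs ht

theorem not_injective_mulMap_tailQ (hd : 1 < d)
    (l : gradedPiece (weightedVertex (tailQ d)) 1) :
    ¬ Function.Injective (mulMap (weightedVertex (tailQ d)) l 1) := by
  have hd0 := Nat.zero_lt_of_lt hd
  refine not_injective_mulMap_of_finrank_lt (multipleSpan_le_gradedPiece hd0)
    (fun f => mul_mem_succMultipleSpan hd0 l.2) ?_
  rw [finrank_multipleSpan hd0, finrank_succMultipleSpan hd]
  exact Nat.sub_lt hd0 one_pos

theorem card_boxIndices_one_le_two (hd : 3 ≤ d) :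
    (boxIndices (tailQ d) 1).card ≤ (boxIndices (tailQ d) 2).card := by
  have hd0 : 0 < d := by omega
  -- If `t ≠ d` has degree one, then `t + 1` has degree two; `2d + 2` is left over for `t = d`.
  refine Finset.card_le_card_of_injOn (fun t => if t = d then d * 2 + 2 else t + 1)
    (fun t ht => ?_) fun s hs t ht hst => ?_
  · obtain ⟨htN, ht1⟩ := mem_boxIndices.1 ht
    obtain ⟨k, hk, b, hb, rfl⟩ := exists_eq_mul_add htN hd0
    rw [boxDegree_tailQ hk hb] at ht1
    obtain ⟨m, hm, c, hc, himage, hdeg⟩ : ∃ m ≤ d, ∃ c < d,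
        (if d * k + b = d then d * 2 + 2 else d * k + b + 1) = d * m + c ∧
          (c + if c < m then 1 else 0) = 2 := by
      by_cases hkb : d * k + b = d
      · exact ⟨2, by omega, 2, hd, if_pos hkb, by simp⟩
      · exact ⟨k, hk, b + 1, by grind, if_neg hkb, by grind⟩
    change (if d * k + b = d then d * 2 + 2 else d * k + b + 1) ∈ boxIndices (tailQ d) 2
    rw [himage]
    exact mem_boxIndices.2
      ⟨(mul_add_lt_totalWeight_iff hc).2 hm, (boxDegree_tailQ hm hc).trans hdeg⟩
  · have hne : ∀ t ∈ (boxIndices (tailQ d) 1 : Set ℕ), t ≠ d * 2 + 1 := by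
      rintro _ ht rfl
      have h := (mem_boxIndices.1 ht).2
      rw [boxDegree_tailQ (by omega) (by omega)] at h
      simp at h
    have hsne := hne s hs
    have htne := hne t ht
    dsimp only at hst
    split_ifs at hst <;> omega

theorem not_surjective_mulMap_tailQ (hd : 3 ≤ d)
    (l : gradedPiece (weightedVertex (tailQ d)) 1) :
    ¬ Function.Surjective (mulMap (weightedVertex (tailQ d)) l 1) := by
  intro hsurj
  have hle := LinearMap.finrank_le_finrank_of_surjective hsurj
  have hge := card_boxIndices_one_le_two hd
  rw [← finrank_gradedPiece, ← finrank_gradedPiece] at hge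
  exact not_injective_mulMap_tailQ (by omega) l
    ((LinearMap.injective_iff_surjective_of_finrank_eq_finrank (hge.antisymm hle)).2 hsurj)

end VertexQ

end LatticeSimplex

theorem proposition4p2 (d : ℕ) (hd : 3 ≤ d) :
    AffineIndependent ℝ (fun i => LatticeSimplex.toReal (LatticeSimplex.vertexQ d i)) ∧
    LatticeSimplex.HasType (LatticeSimplex.vertexQ d) (LatticeSimplex.weightQ d) 1 ∧
    LatticeSimplex.IsIntegrallyClosed (LatticeSimplex.simplex (LatticeSimplex.vertexQ d)) ∧
    LatticeSimplex.IsReflexive (LatticeSimplex.simplex (LatticeSimplex.vertexQ d)) ∧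
    IsArtinianRing (LatticeSimplex.R (LatticeSimplex.vertexQ d)) ∧
    (∀ l : LatticeSimplex.gradedPiece (LatticeSimplex.vertexQ d) 1,
      ¬ Function.Injective (LatticeSimplex.mulMap (LatticeSimplex.vertexQ d) l 1)) ∧
    ¬ ∃ l : LatticeSimplex.gradedPiece (LatticeSimplex.vertexQ d) 1,
      LatticeSimplex.IsWeakLefschetz (LatticeSimplex.vertexQ d) l := by
  open LatticeSimplex in
  have hd0 : 0 < d := by omega
  rw [vertexQ_eq_weightedVertex, weightQ_eq_cons]
  exact ⟨affineIndependent_weightedVertex _, hasType_weightedVertex _,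
    isIntegrallyClosed_simplex_tailQ hd0, isReflexive_simplex_weightedVertex tailQ_dvd_totalWeight,
    IsArtinianRing.of_finite ℂ _, not_injective_mulMap_tailQ (by omega),
    fun ⟨l, hl⟩ => (hl 1).elim (not_injective_mulMap_tailQ (by omega) l)
      (not_surjective_mulMap_tailQ hd l)⟩
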